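/- Let $T$ be a finite CW-complex, $A$ a finitely generated abelian group and $k\ge 0$. Write $T_j$ for the set of $j$-cells of $T$ (oriented by their characteristic maps; $T_{-1}=\emptyset$), and $[\beta:\alpha]\in\mathbb Z$ for the cellular incidence numbers, so that $\partial\beta=\sum_{\alpha}[\beta:\alpha]\,\alpha$; $H_k(T,A)$ and $H^k(T,A)$ denote cellular (co)homology. With $\mathbb Z_0:=\mathbb Z$, there are $d_1,\dots,d_m\ge 0$ with $A\cong\prod_{i=1}^m\mathbb Z_{d_i}$. Fix any such isomorphism. For each $i$ let $\zeta_i$ be a primitive $d_i$-th root of unity if $d_i>0$, and $\zeta_i=e^{2\pi\sqrt{-1}\,r_i}$ with $r_i$ irrational if $d_i=0$. Place on every $k$-cell $\beta$, for every $i$, a qudit with basis $|n\rangle$, $n\in\mathbb Z_{d_i}$, and operators $X_{\beta,i}|n\rangle=|n+1\rangle$ and $Z_{\beta,i}|n\rangle=\zeta_i^{\,n}|n\rangle$. The joint basis states $|c\rangle$ are thus indexed by the $k$-chains $c\in\bigoplus_{\beta\in T_k}A$, and the state space is the space of all maps from these chains to $\mathbb C$ (the tensor product of the qudits $\mathbb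 C^{d_i}$ if $A$ is finite). For a group $M$, let $\mathbb C[M]$ denote the space of all maps $M\to\mathbb C$; for finite $M$ this is the group algebra, and in general it contains the group algebra as the finitely supported maps. (1) The operators $$V_{\alpha,i}=\prod_{\beta\in T_k}Z_{\beta,i}^{[\beta:\alpha]}\ (\alpha\in T_{k-1}),\qquad P_{\gamma,i}=\prod_{\beta\in T_k}X_{\beta,i}^{[\gamma:\beta]}\ (\gamma\in T_{k+1}),\qquad 1\le i\le m,$$ commute pairwise, and so define a stabilizer code. Its code space, the common $1$-eigenspace, is isomorphic to $\mathbb C[H_k(T,A)]$: a map $\varphi:H_k(T,A)\to\mathbb C$ corresponds to the state whose coefficient at $|c\rangle$ is $\varphi([c])$ if $c$ is a cycle and $0$ otherwise. In particular a class $h$ corresponds to the equal superposition of all cycles in $h$. If $A$ is finite, the code space is the ground space of the Hamiltonian $\sum_{S}(2-S-S^\dagger)$, the sum running over all stabilizers $V_{\alpha,i}$, $P_{\gamma,i}$. (2) The same holds for the operators $V_{\alpha,i}=\prod_{\beta}X_{\beta,i}^{[\beta:\alpha]}$ and $P_{\gamma,i}=\prod_\beta Z_{\beta,i}^{[\gamma:\beta]}$,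 with cochains, cocycles and $H^k(T,A)$ in place of chains, cycles and $H_k(T,A)$. (3) $H_k(T,A)\cong\bigoplus_{i}H_k(T,\mathbb Z_{d_i})$ and $H^k(T,A)\cong\bigoplus_i H^k(T,\mathbb Z_{d_i})$. -/

import Mathlib

open Topology

universe u v

noncomputable section

/-! ### Singular cubes

The characteristic maps of Mathlib's CW complexes are defined on the cubes `[-1,1]ⁿ` (closed unit
balls of the maximum norm), so the cellular boundary is expressed through cubical singular
chains: formal sums of maps `[-1,1]ⁿ → X`, taken modulo degenerate cubes. -/

/-- The standard `n`-cube `[-1,1]ⁿ`. -/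
abbrev StdCube (n : ℕ) : Type := Metric.closedBall (0 : Fin n → ℝ) 1

/-- The face inclusion `[-1,1]ⁿ → [-1,1]ⁿ⁺¹` which inserts the value `s` as `i`-th coordinate. -/
def cubeFace {n : ℕ} (i : Fin (n + 1)) (s : ℝ) (hs : |s| ≤ 1) : C(StdCube n, StdCube (n + 1)) where
  toFun x := ⟨i.insertNth s x.1, by
    have hx : ‖x.1‖ ≤ 1 := mem_closedBall_zero_iff.mp x.2
    rw [mem_closedBall_zero_iff, pi_norm_le_iff_of_nonneg zero_le_one]
    intro j
    rcases Fin.eq_self_or_eq_succAbove i j with rfl | ⟨j, rfl⟩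
    · simpa using hs
    · simpa using (norm_le_pi_norm x.1 j).trans hx⟩
  continuous_toFun := by
    refine Continuous.subtype_mk ?_ _
    exact Continuous.finInsertNth i continuous_const continuous_subtype_val

/-- Cubical singular `n`-chains of `X` with integer coefficients (not yet normalized). -/
abbrev CubeChain (X : Type u) [TopologicalSpace X] (n : ℕ) : Type u := C(StdCube n, X) →₀ ℤ

/-- The cubical boundary `∂σ = ∑ᵢ (-1)ⁱ (σ|_{xᵢ = 1} - σ|_{xᵢ = -1})`. -/
def cubeBoundary (X : Type u) [TopologicalSpace X] (n : ℕ) :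
    CubeChain X (n + 1) →ₗ[ℤ] CubeChain X n :=
  Finsupp.linearCombination ℤ fun σ =>
    ∑ i : Fin (n + 1), (-1 : ℤ) ^ (i : ℕ) •
      (Finsupp.single (σ.comp (cubeFace i 1 (by simp))) (1 : ℤ) -
        Finsupp.single (σ.comp (cubeFace i (-1) (by simp))) (1 : ℤ))

/-- The chains all of whose cubes have their image in `S`. -/
def cubeChainsIn {X : Type u} [TopologicalSpace X] (S : Set X) (n : ℕ) :
    Submodule ℤ (CubeChain X n) :=
  Submodule.span ℤ {c | ∃ σ : C(StdCube n, X), Set.range σ ⊆ S ∧ c = Finsupp.single σ 1}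

/-- The chains spanned by the degenerate cubes: those that do not depend on some coordinate. -/
def degenerateCubeChains (X : Type u) [TopologicalSpace X] (n : ℕ) :
    Submodule ℤ (CubeChain X n) :=
  Submodule.span ℤ {c | ∃ σ : C(StdCube n, X),
    (∃ i : Fin n, ∀ x y : StdCube n, (∀ j, j ≠ i → x.1 j = y.1 j) → σ x = σ y) ∧
      c = Finsupp.single σ 1}

/-! ### The cellular chain complex of a CW complex -/

section Cellular

variable {X : Type u} [TopologicalSpace X] [T2Space X] (T : Set X) [CWComplex T]

/-- The characteristic map of an `n`-cell, as a singular cube of `X`. -/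
def cellCube {n : ℕ} (e : RelCWComplex.cell T n) : C(StdCube n, X) where
  toFun x := RelCWComplex.map (C := T) n e x.1
  continuous_toFun :=
    (RelCWComplex.continuousOn (C := T) n e).comp_continuous continuous_subtype_val fun x => x.2

/-- The cellular chain complex of `T`. The chain group in degree `n` is free on the `n`-cells,
oriented by their characteristic maps, and the incidence numbers `[e : f] = bd n e f` are determined
by the topology: writing `Tₙ` for the `n`-skeleton, the boundary of the characteristic cube of an
`(n+1)`-cell `e` represents `∑_f [e : f] f` in the relative singular homology group
`Hₙ(Tₙ, Tₙ₋₁)`, which is free on the characteristic cubes of the `n`-cells `f`. -/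
structure CellularChainComplex where
  /-- The incidence numbers of an `(n+1)`-cell with the `n`-cells. -/
  bd (n : ℕ) : RelCWComplex.cell T (n + 1) → (RelCWComplex.cell T n →₀ ℤ)
  /-- `∂e = ∑_f [e : f] f` in `Hₙ(Tₙ, Tₙ₋₁)`. -/
  bd_spec (n : ℕ) (e : RelCWComplex.cell T (n + 1)) :
    cubeBoundary X n (Finsupp.single (cellCube T e) 1) -
        (bd n e).sum (fun f a => Finsupp.single (cellCube T f) a) ∈
      cubeChainsIn (RelCWComplex.skeletonLT T n : Set X) n ⊔
        degenerateCubeChains X n ⊔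
        (cubeChainsIn (RelCWComplex.skeletonLT T (n + 1 : ℕ) : Set X) (n + 1)).map (cubeBoundary X n)
  /-- It is a complex. -/
  bd_bd (n : ℕ) (e : RelCWComplex.cell T (n + 2)) :
    Finsupp.linearCombination ℤ (bd n) (bd (n + 1) e) = 0

open Classical in
/-- The incidence number `[e : f]` of an `(n+1)`-cell `e` with an `n`-cell `f`, that is, the
coefficient of `f` in the cellular boundary of `e`. (Every CW complex has exactly one cellular chain
complex in the above sense; the value `0` is only there to make the definition total.) -/
def cellularIncidence (n : ℕ) (e : RelCWComplex.cell T (n + 1)) (f : RelCWComplex.cell T n) : ℤ :=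
  if h : Nonempty (CellularChainComplex T) then h.some.bd n e f else 0

/-- The cells of dimension `k - 1`; there are none if `k = 0`. -/
abbrev PrevCell : ℕ → Type u
  | 0 => PEmpty
  | k + 1 => RelCWComplex.cell T k

/-- The incidence number `[e : f]` of a `k`-cell `e` with a `(k-1)`-cell `f`. -/
def incidence : ∀ k : ℕ, RelCWComplex.cell T k → PrevCell T k → ℤ
  | 0 => fun _ f => f.elim
  | k + 1 => cellularIncidence T k

variable [RelCWComplex.Finite T]

instance finite_cell_of_finite (k : ℕ) : Finite (RelCWComplex.cell T k) :=
  RelCWComplex.FiniteType.finite_cell k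

instance finite_prevCell_of_finite : ∀ k : ℕ, Finite (PrevCell T k)
  | 0 => inferInstanceAs (Finite PEmpty)
  | k + 1 => finite_cell_of_finite T k

instance fintypeCell (k : ℕ) : Fintype (RelCWComplex.cell T k) := Fintype.ofFinite _

instance fintypePrevCell (k : ℕ) : Fintype (PrevCell T k) := Fintype.ofFinite _

variable (A : Type v) [AddCommGroup A]

/-- The boundary map on `k`-chains with coefficients in `A`. As `T` is finite, a `k`-chain
`∑ z_e e` is just a family `z` of elements of `A` indexed by the `k`-cells. -/
def boundaryHom (k : ℕ) : (RelCWComplex.cell T k → A) →+ (PrevCell T k → A) where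
  toFun z f := ∑ e, incidence T k e f • z e
  map_zero' := by ext; simp
  map_add' z w := by ext; simp [Finset.sum_add_distrib]

/-- The coboundary map from `(k-1)`-cochains to `k`-cochains with coefficients in `A`. -/
def coboundaryHom (k : ℕ) : (PrevCell T k → A) →+ (RelCWComplex.cell T k → A) where
  toFun z e := ∑ f, incidence T k e f • z f
  map_zero' := by ext; simp
  map_add' z w := by ext; simp [Finset.sum_add_distrib]

def cellularCycles (k : ℕ) : AddSubgroup (RelCWComplex.cell T k → A) := (boundaryHom T A k).ker

def cellularBoundaries (k : ℕ) : AddSubgroup (RelCWComplex.cell T k → A) :=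
  (boundaryHom T A (k + 1)).range

def cellularCocycles (k : ℕ) : AddSubgroup (RelCWComplex.cell T k → A) :=
  (coboundaryHom T A (k + 1)).ker

def cellularCoboundaries (k : ℕ) : AddSubgroup (RelCWComplex.cell T k → A) :=
  (coboundaryHom T A k).range

/-- The homology group `H_k(T, A)`. -/
abbrev CellularHomology (k : ℕ) : Type (max u v) :=
  cellularCycles T A k ⧸ (cellularBoundaries T A k).addSubgroupOf (cellularCycles T A k)

/-- The cohomology group `H^k(T, A)`. -/
abbrev CellularCohomology (k : ℕ) : Type (max u v) :=
  cellularCocycles T A k ⧸ (cellularCoboundaries T A k).addSubgroupOf (cellularCocycles T A k)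

open Classical in
/-- The homology class of a chain, if the chain is a cycle. -/
def homologyClass (k : ℕ) (z : RelCWComplex.cell T k → A) : Option (CellularHomology T A k) :=
  if h : z ∈ cellularCycles T A k then some (QuotientAddGroup.mk ⟨z, h⟩) else none

open Classical in
/-- The cohomology class of a cochain, if the cochain is a cocycle. -/
def cohomologyClass (k : ℕ) (z : RelCWComplex.cell T k → A) : Option (CellularCohomology T A k) :=
  if h : z ∈ cellularCocycles T A k then some (QuotientAddGroup.mk ⟨z, h⟩) else none

end Cellular

/-! ### Stabilizer codes -/

section Codes

variable {P : Type u} (d : P → ℕ)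

/-- Labels of the computational basis of a family of qudits: the qudit `p` has the basis vectors
`|n⟩`, `n ∈ ℤ/d(p)`. For `d(p) = 0` this is `ℤ/0 = ℤ`, an infinite-dimensional qudit. -/
abbrev QuditConfig : Type u := ∀ p, ZMod (d p)

/-- State vectors: maps from the computational basis to `ℂ`. If all qudits are finite-dimensional
and there are finitely many of them, this is `⨂ₚ ℂ^{d(p)}`. -/
abbrev QuditState : Type u := QuditConfig d → ℂ

/-- The tensor product `⨂ₚ Xₚ^{a(p)}` of powers of shift operators `Xₚ|n⟩ = |n+1⟩`. It sends
the basis vector `|c⟩` to `|c + a⟩`. -/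
def shiftOp (a : P → ℤ) : Module.End ℂ (QuditState d) where
  toFun f c := f (fun p => c p - (a p : ZMod (d p)))
  map_add' _ _ := rfl
  map_smul' _ _ := rfl

/-- The tensor product `⨂ₚ Zₚ^{b(p)}` of powers of clock operators `Zₚ|n⟩ = ζₚⁿ|n⟩`. -/
def clockOp [Fintype P] (ζ : P → ℂ) (b : P → ℤ) : Module.End ℂ (QuditState d) where
  toFun f c := (∏ p, (ζ p ^ ((c p).cast : ℤ)) ^ b p) * f c
  map_add' f g := by ext c; simp [mul_add]
  map_smul' r f := by ext c; simp [mul_left_comm]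

/-- The phases allowed in a clock operator: a primitive `d`-th root of unity for a `d`-dimensional
qudit, and `e^{2πir}` with `r` irrational for an infinite-dimensional one (`d = 0`). -/
def IsClockPhase (d : ℕ) (ζ : ℂ) : Prop :=
  (d ≠ 0 → IsPrimitiveRoot ζ d) ∧
    (d = 0 → ∃ r : ℝ, Irrational r ∧ ζ = Complex.exp (2 * Real.pi * Complex.I * r))

/-- A stabilizer code on the qudits `P` with generators indexed by `G`: a family of commuting
generalized Pauli operators, i.e. tensor products of powers of clock and shift operators up to
a phase. -/
structure StabilizerCode [Fintype P] (ζ : P → ℂ) (G : Type v) where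
  op : G → Module.End ℂ (QuditState d)
  isPauli (g : G) : ∃ (w : ℂ) (a b : P → ℤ), ‖w‖ = 1 ∧ op g = w • (shiftOp d a * clockOp d ζ b)
  commute (g h : G) : Commute (op g) (op h)

variable {d}

/-- The common `1`-eigenspace of the stabilizers. -/
def StabilizerCode.codeSpace [Fintype P] {ζ : P → ℂ} {G : Type v} (S : StabilizerCode d ζ G) :
    Submodule ℂ (QuditState d) :=
  ⨅ g, LinearMap.ker (S.op g - 1)

open Classical in
/-- The adjoint for the standard inner product, if there are finitely many configurations. -/
def adjointOp [Fintype (QuditConfig d)] (f : Module.End ℂ (QuditState d)) :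
    Module.End ℂ (QuditState d) :=
  Matrix.toLin' (LinearMap.toMatrix' f).conjTranspose

/-- The Hamiltonian `∑ (2 - S - S†)`, the sum running over the stabilizers. -/
def StabilizerCode.hamiltonian [Fintype P] {ζ : P → ℂ} {G : Type v} [Fintype G]
    [Fintype (QuditConfig d)] (S : StabilizerCode d ζ G) : Module.End ℂ (QuditState d) :=
  ∑ g, ((2 : ℂ) • 1 - S.op g - adjointOp (S.op g))

/-- `W` is the ground space of `H`: the eigenspace of the least eigenvalue, all eigenvalues being
real. -/
def IsGroundSpace {V : Type u} [AddCommGroup V] [Module ℂ V] (H : Module.End ℂ V)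
    (W : Submodule ℂ V) : Prop :=
  ∃ E : ℝ, H.HasEigenvalue (E : ℂ) ∧
    (∀ μ : ℂ, H.HasEigenvalue μ → ∃ x : ℝ, μ = x ∧ E ≤ x) ∧ W = H.eigenspace (E : ℂ)

/-- The space `W` of states encodes `ℂ[M]`, where `cl` assigns to some of the basis labels an
element of `M`. The maps `M → ℂ` correspond linearly and bijectively to `W`: the map `φ` to the
state whose coefficient at `|c⟩` is `φ (cl c)`, or `0` if `c` has no class. In particular
`h ∈ M` corresponds to the superposition of all `|c⟩` of class `h`, with equal coefficients.
This embeds the algebraic group algebra (finite formal sums) in `W`, onto `W` if `M` is finite. -/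
def Encodes {C : Type u} {M : Type v} [AddCommGroup M] (W : Submodule ℂ (C → ℂ))
    (cl : C → Option M) : Prop :=
  ∃ Φ : (M → ℂ) ≃ₗ[ℂ] W,
    (∀ φ c, (Φ φ : C → ℂ) c = (cl c).elim 0 φ) ∧
    ∃ Ψ : AddMonoidAlgebra ℂ M →ₗ[ℂ] W, Function.Injective Ψ ∧
      (∀ h : M, ∀ c, (Ψ (AddMonoidAlgebra.single h 1) : C → ℂ) c =
        (cl c).elim 0 (Set.indicator {h} 1)) ∧
      (Finite M → Function.Surjective Ψ)

end Codes

section CellularCodes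

variable {X : Type u} [TopologicalSpace X] [T2Space X] (T : Set X) [CWComplex T] (k : ℕ) {m : ℕ}

/-- Exponents supported on the qudits of the `i`-th code: `a e` on the qudit `(e, i)`. -/
def onFactor {K : Type u} (i : Fin m) (a : K → ℤ) : K × Fin m → ℤ :=
  fun p => if p.2 = i then a p.1 else 0

/-- The dimensions of the qudits: for every `k`-cell one qudit for each factor `ℤ/dᵢ`. -/
abbrev cellDim (d : Fin m → ℕ) : RelCWComplex.cell T k × Fin m → ℕ := fun p => d p.2

/-- The phases of the clock operators: all qudits of the `i`-th code use `ζᵢ`. -/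
abbrev cellPhase (ζ : Fin m → ℂ) : RelCWComplex.cell T k × Fin m → ℂ := fun p => ζ p.2

/-- Index type of the stabilizers: for each factor one for every `(k-1)`-cell and one for every
`(k+1)`-cell. -/
abbrev CellGen (m : ℕ) : Type u :=
  (PrevCell T k × Fin m) ⊕ (RelCWComplex.cell T (k + 1) × Fin m)

/-- The `A`-chain corresponding to a basis label under `A ≅ ∏ᵢ ℤ/dᵢ`. -/
def chainOfConfig {d : Fin m → ℕ} {A : Type v} [AddCommGroup A] (e : A ≃+ ∀ i, ZMod (d i))
    (c : QuditConfig (cellDim T k d)) : RelCWComplex.cell T k → A :=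
  fun β => e.symm fun i => c (β, i)

end CellularCodes

end

/-! The code is of CSS type: its generators are purely clock or purely shift operators, given by
integer matrices `N` and `M` whose composite vanishes. The clock stabilizer of `(α, i)` is diagonal,
and its eigenvalue on `|c⟩` is `ζᵢ` raised to the `i`-th coordinate of `∂c` at `α`. Since `ζᵢ ^ n =
1` exactly when `n = 0` in `ZMod (d i)`, a state is fixed by all clock stabilizers iff it is
supported on cycles (`configAddEquiv_mem_ker_iff`). The shift stabilizers translate by the
boundaries of elementary chains, which generate all boundaries, so a state is fixed by them iff its
coefficients are constant on cosets of the boundaries (`forall_shift_invariant_iff`). Common fixed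
states are thus the functions on cycles modulo boundaries (`encodes_codeSpace_cssCode`).

A clock and a shift operator commute up to a phase whose exponent is an entry of the composite
matrix, so commutation amounts to `∂∂ = 0`; this is the only topological input
(`sum_incidence_mul_incidence`). Transposing both matrices gives the cohomology code.

The stabilizers are unitary, whence `⟨f, Hf⟩ = ∑ ‖f - Sf‖²`. So `H` is positive semidefinite with
kernel the code space, which is nonzero because it encodes functions on a nonempty set. The
splitting along the factors of `A` holds because integer matrices act coordinatewise on `∏ᵢ ZMod (d
i)`. -/

noncomputable section

/-! ### Clock phases and the cyclic decomposition of the coefficients -/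

section Phases

lemma IsClockPhase.norm_eq_one {d : ℕ} {ζ : ℂ} (h : IsClockPhase d ζ) : ‖ζ‖ = 1 := by
  rcases eq_or_ne d 0 with hd | hd
  · obtain ⟨r, -, rfl⟩ := h.2 hd
    rw [Complex.norm_exp]
    simp
  · exact (h.1 hd).norm'_eq_one hd

lemma IsClockPhase.ne_zero {d : ℕ} {ζ : ℂ} (h : IsClockPhase d ζ) : ζ ≠ 0 := by
  rw [← norm_pos_iff, h.norm_eq_one]
  exact one_pos

/-- This faithfulness is the reason for both conditions on the phase: primitivity for `d > 0`,
irrationality for `d = 0`. It lets clock eigenvalues detect vanishing in `ZMod d`. -/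
lemma IsClockPhase.zpow_eq_one_iff {d : ℕ} {ζ : ℂ} (h : IsClockPhase d ζ) (n : ℤ) :
    ζ ^ n = 1 ↔ (n : ZMod d) = 0 := by
  rcases eq_or_ne d 0 with hd | hd
  · obtain ⟨r, hr, rfl⟩ := h.2 hd
    subst hd
    rw [← Complex.exp_int_mul, Complex.exp_eq_one_iff]
    constructor
    · rintro ⟨j, hj⟩
      have hpi : (2 * Real.pi * Complex.I : ℂ) ≠ 0 := Complex.two_pi_I_ne_zero
      have h1 : ((n : ℝ) * r : ℝ) = (j : ℝ) := by
        have h2 : (2 * Real.pi * Complex.I : ℂ) * (n * r) = (2 * Real.pi * Complex.I : ℂ) * j := by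
          linear_combination hj
        exact_mod_cast mul_left_cancel₀ hpi h2
      -- A nonzero integer multiple of an irrational number is not an integer. As `ZMod 0` is `ℤ` by
      -- definition, `hn` already concerns the integer `n`.
      by_contra hn
      have hn' : n ≠ 0 := hn
      exact (hr.intCast_mul hn').ne_int j h1
    · intro hn
      have hn' : n = 0 := hn
      exact ⟨0, by simp [hn']⟩
  · have : NeZero d := ⟨hd⟩
    rw [(h.1 hd).zpow_eq_one_iff_dvd, ZMod.intCast_zmod_eq_zero_iff_dvd]

lemma IsClockPhase.zpow_eq_zpow_iff {d : ℕ} {ζ : ℂ} (h : IsClockPhase d ζ) (n l : ℤ) :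
    ζ ^ n = ζ ^ l ↔ (n : ZMod d) = l := by
  rw [← sub_eq_zero (a := (n : ZMod d)), ← Int.cast_sub, ← h.zpow_eq_one_iff,
    zpow_sub₀ h.ne_zero, div_eq_one_iff_eq (zpow_ne_zero _ h.ne_zero)]

lemma exists_isClockPhase (d : ℕ) : ∃ ζ : ℂ, IsClockPhase d ζ := by
  rcases eq_or_ne d 0 with hd | hd
  · exact ⟨_, fun h => (h hd).elim, fun _ => ⟨√2, irrational_sqrt_two, rfl⟩⟩
  · exact ⟨_, fun _ => Complex.isPrimitiveRoot_exp d hd, fun h => (hd h).elim⟩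

/-- A finitely generated abelian group is a finite product of cyclic groups. -/
lemma exists_addEquiv_pi_zmod (A : Type v) [AddCommGroup A] [AddGroup.FG A] :
    ∃ (m : ℕ) (d : Fin m → ℕ), Nonempty (A ≃+ ∀ i, ZMod (d i)) := by
  obtain ⟨n, ι, _, p, -, r, ⟨f⟩⟩ := AddCommGroup.equiv_free_prod_directSum_zmod A
  -- A free summand `ℤ` is recorded as `ZMod 0`.
  let D : Fin n ⊕ ι → ℕ := Sum.elim (fun _ => 0) fun i => p i ^ r i
  let g := Fintype.equivFin (Fin n ⊕ ι)
  have e₁ : ((Fin n →₀ ℤ) × DirectSum ι fun i => ZMod (p i ^ r i)) ≃+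
      ((∀ i : Fin n, ZMod (D (Sum.inl i))) × ∀ i : ι, ZMod (D (Sum.inr i))) :=
    AddEquiv.prodCongr (Finsupp.linearEquivFunOnFinite ℤ ℤ (Fin n)).toAddEquiv
      (DirectSum.addEquivProd _)
  have e₂ := (LinearEquiv.sumPiEquivProdPi ℤ (Fin n) ι fun s => ZMod (D s)).toAddEquiv
  have e₃ := (LinearEquiv.piCongrLeft' ℤ (fun s => ZMod (D s)) g).toAddEquiv
  exact ⟨_, fun i => D (g.symm i), ⟨f.trans (e₁.trans (e₂.symm.trans e₃))⟩⟩

end Phases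

/-! ### Commutation and fixed vectors of clock and shift operators -/

section Pauli

variable {P : Type u} {d : P → ℕ}

@[simp]
lemma shiftOp_apply (a : P → ℤ) (f : QuditState d) (c : QuditConfig d) :
    shiftOp d a f c = f (fun p => c p - (a p : ZMod (d p))) := rfl

lemma shiftOp_zero : shiftOp d 0 = 1 := by
  ext f c
  simp

lemma commute_shiftOp (a a' : P → ℤ) : Commute (shiftOp d a) (shiftOp d a') := by
  refine LinearMap.ext fun f => funext fun c => ?_
  simp only [Module.End.mul_apply, shiftOp_apply]
  exact congrArg f (funext fun p => sub_right_comm _ _ _)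

lemma mem_ker_shiftOp_sub_one {a : P → ℤ} {f : QuditState d} :
    f ∈ LinearMap.ker (shiftOp d a - 1) ↔
      ∀ c : QuditConfig d, f (fun p => c p - (a p : ZMod (d p))) = f c := by
  rw [LinearMap.mem_ker, LinearMap.sub_apply, sub_eq_zero, funext_iff]
  rfl

variable [Fintype P] {ζ : P → ℂ}

@[simp]
lemma clockOp_apply (b : P → ℤ) (f : QuditState d) (c : QuditConfig d) :
    clockOp d ζ b f c = (∏ p, (ζ p ^ ((c p).cast : ℤ)) ^ b p) * f c := rfl

lemma clockOp_zero : clockOp d ζ 0 = 1 := by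
  ext f c
  simp

lemma commute_clockOp (b b' : P → ℤ) : Commute (clockOp d ζ b) (clockOp d ζ b') := by
  refine LinearMap.ext fun f => funext fun c => ?_
  simp only [Module.End.mul_apply, clockOp_apply]
  exact mul_left_comm _ _ _

/-- Moving the clock past the shift changes its phase from that at `c` to that at `c - a`; the
quotient of the two is the product assumed to be `1`. -/
lemma commute_clockOp_shiftOp (hζ : ∀ p, IsClockPhase (d p) (ζ p)) {a b : P → ℤ}
    (h : ∏ p, ζ p ^ (a p * b p) = 1) : Commute (clockOp d ζ b) (shiftOp d a) := by
  refine LinearMap.ext fun f => funext fun c => ?_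
  simp only [Module.End.mul_apply, clockOp_apply, shiftOp_apply]
  congr 1
  rw [← mul_one (∏ p, (ζ p ^ ((c p - (a p : ZMod (d p))).cast : ℤ)) ^ b p), ← h,
    ← Finset.prod_mul_distrib]
  refine Finset.prod_congr rfl fun p _ => ?_
  rw [zpow_mul, ← mul_zpow, ← zpow_add₀ (hζ p).ne_zero]
  congr 1
  -- The integer representatives of `c p - a p` and `c p` need not differ by `a p`, but they do
  -- modulo `d p`, which is all the phase sees.
  rw [(hζ p).zpow_eq_zpow_iff]
  simp

lemma mem_ker_clockOp_sub_one {b : P → ℤ} {f : QuditState d} :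
    f ∈ LinearMap.ker (clockOp d ζ b - 1) ↔
      ∀ c : QuditConfig d, ∏ p, (ζ p ^ ((c p).cast : ℤ)) ^ b p ≠ 1 → f c = 0 := by
  rw [LinearMap.mem_ker, LinearMap.sub_apply, sub_eq_zero, funext_iff]
  refine forall_congr' fun c => ?_
  rw [clockOp_apply, Module.End.one_apply, mul_left_eq_self₀]
  tauto

lemma StabilizerCode.mem_codeSpace {G : Type v} (S : StabilizerCode d ζ G) {f : QuditState d} :
    f ∈ S.codeSpace ↔ ∀ x, S.op x f = f := by
  simp [StabilizerCode.codeSpace, sub_eq_zero]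

end Pauli

/-! ### Unitarity of the stabilizers and positivity of the Hamiltonian -/

section GroundSpace

variable {P : Type u} {d : P → ℕ} [Fintype (QuditConfig d)]

lemma star_dotProduct_adjointOp (S : Module.End ℂ (QuditState d)) (f g : QuditState d) :
    star f ⬝ᵥ adjointOp S g = star (S f) ⬝ᵥ g := by
  -- The instance is kept arbitrary so that the result matches the classical one inside `adjointOp`.
  have h (_ : DecidableEq (QuditConfig d)) :
      star f ⬝ᵥ Matrix.toLin' (LinearMap.toMatrix' S).conjTranspose g = star (S f) ⬝ᵥ g := by
    rw [Matrix.toLin'_apply, Matrix.dotProduct_mulVec, ← Matrix.star_mulVec,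
      LinearMap.toMatrix'_mulVec]
  exact h _

lemma star_shiftOp_dotProduct_shiftOp (a : P → ℤ) (f g : QuditState d) :
    star (shiftOp d a f) ⬝ᵥ shiftOp d a g = star f ⬝ᵥ g :=
  (Equiv.subRight (fun p => (a p : ZMod (d p)) : QuditConfig d)).sum_comp
    fun c => star (f c) * g c

variable [Fintype P] {ζ : P → ℂ}

lemma star_clockOp_dotProduct_clockOp (hζ : ∀ p, ‖ζ p‖ = 1) (b : P → ℤ) (f g : QuditState d) :
    star (clockOp d ζ b f) ⬝ᵥ clockOp d ζ b g = star f ⬝ᵥ g := by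
  refine Finset.sum_congr rfl fun c _ => ?_
  have h : ‖∏ p, (ζ p ^ ((c p).cast : ℤ)) ^ b p‖ = 1 := by
    simp [norm_prod, norm_zpow, hζ]
  simp only [Pi.star_apply, clockOp_apply, star_mul']
  rw [mul_mul_mul_comm, Complex.star_def, Complex.conj_mul', h]
  simp

/-- The stabilizers of a code are unitary. -/
lemma StabilizerCode.star_op_dotProduct_op {G : Type v} (S : StabilizerCode d ζ G)
    (hζ : ∀ p, ‖ζ p‖ = 1) (x : G) (f g : QuditState d) :
    star (S.op x f) ⬝ᵥ S.op x g = star f ⬝ᵥ g := by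
  obtain ⟨w, a, b, hw, h⟩ := S.isPauli x
  rw [h, LinearMap.smul_apply, LinearMap.smul_apply, star_smul, smul_dotProduct, dotProduct_smul,
    smul_smul, Complex.star_def, Complex.conj_mul', hw, Module.End.mul_apply, Module.End.mul_apply,
    star_shiftOp_dotProduct_shiftOp, star_clockOp_dotProduct_clockOp hζ]
  simp

lemma star_dotProduct_self_eq_ofReal {C : Type u} [Fintype C] (f : C → ℂ) :
    star f ⬝ᵥ f = ((∑ c, ‖f c‖ ^ 2 : ℝ) : ℂ) := by
  rw [dotProduct, Complex.ofReal_sum]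
  refine Finset.sum_congr rfl fun c _ => ?_
  rw [Pi.star_apply, Complex.star_def, Complex.conj_mul', Complex.ofReal_pow]

lemma sum_norm_sq_eq_zero_iff {C : Type u} [Fintype C] (f : C → ℂ) :
    ∑ c, ‖f c‖ ^ 2 = 0 ↔ f = 0 := by
  rw [Finset.sum_eq_zero_iff_of_nonneg fun _ _ => sq_nonneg _]
  simp [funext_iff]

/-- By unitarity, `‖f - Sf‖² = 2⟨f, f⟩ - ⟨f, Sf⟩ - ⟨Sf, f⟩`, and `⟨Sf, f⟩ = ⟨f, S†f⟩`. -/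
lemma StabilizerCode.star_dotProduct_hamiltonian {G : Type v} [Fintype G]
    (S : StabilizerCode d ζ G) (hζ : ∀ p, ‖ζ p‖ = 1) (f : QuditState d) :
    star f ⬝ᵥ S.hamiltonian f = ((∑ x, ∑ c, ‖(f - S.op x f) c‖ ^ 2 : ℝ) : ℂ) := by
  rw [Complex.ofReal_sum, StabilizerCode.hamiltonian, LinearMap.sum_apply, dotProduct_sum]
  refine Finset.sum_congr rfl fun x _ => ?_
  rw [← star_dotProduct_self_eq_ofReal]
  simp only [LinearMap.sub_apply, LinearMap.smul_apply, Module.End.one_apply, dotProduct_sub,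
    star_sub, sub_dotProduct, dotProduct_smul, star_dotProduct_adjointOp,
    S.star_op_dotProduct_op hζ, smul_eq_mul]
  ring

lemma StabilizerCode.hamiltonian_apply_eq_zero_iff {G : Type v} [Fintype G]
    (S : StabilizerCode d ζ G) (hζ : ∀ p, ‖ζ p‖ = 1) (f : QuditState d) :
    S.hamiltonian f = 0 ↔ f ∈ S.codeSpace := by
  rw [S.mem_codeSpace]
  constructor
  · intro h x
    have h1 := S.star_dotProduct_hamiltonian hζ f
    rw [h, dotProduct_zero] at h1
    have h2 : ∑ x, ∑ c, ‖(f - S.op x f) c‖ ^ 2 = 0 := by exact_mod_cast h1.symm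
    rw [Finset.sum_eq_zero_iff_of_nonneg fun _ _ => Finset.sum_nonneg fun _ _ => sq_nonneg _] at h2
    exact (sub_eq_zero.mp ((sum_norm_sq_eq_zero_iff _).mp (h2 x (Finset.mem_univ x)))).symm
  · intro h
    rw [StabilizerCode.hamiltonian, LinearMap.sum_apply]
    refine Finset.sum_eq_zero fun x _ => ?_
    -- If `Sf = f`, then `⟨g, S†f⟩ = ⟨Sg, f⟩ = ⟨Sg, Sf⟩ = ⟨g, f⟩` for all `g`; take `g = S†f - f`.
    have hadj : adjointOp (S.op x) f = f := by
      refine sub_eq_zero.mp ((sum_norm_sq_eq_zero_iff _).mp ?_)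
      have h1 : ∀ g, star g ⬝ᵥ (adjointOp (S.op x) f - f) = 0 := by
        intro g
        rw [dotProduct_sub, star_dotProduct_adjointOp, ← S.star_op_dotProduct_op hζ x g f, h x,
          sub_self]
      have h2 := h1 (adjointOp (S.op x) f - f)
      rw [star_dotProduct_self_eq_ofReal] at h2
      exact_mod_cast h2
    rw [LinearMap.sub_apply, LinearMap.sub_apply, LinearMap.smul_apply, Module.End.one_apply,
      h x, hadj, two_smul]
    abel

/-- The code space, if it is not trivial, is the ground space of the Hamiltonian. -/
theorem StabilizerCode.isGroundSpace_codeSpace {G : Type v} [Fintype G]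
    (S : StabilizerCode d ζ G) (hζ : ∀ p, ‖ζ p‖ = 1) (hS : S.codeSpace ≠ ⊥) :
    IsGroundSpace S.hamiltonian S.codeSpace := by
  have hker : S.codeSpace = S.hamiltonian.eigenspace ((0 : ℝ) : ℂ) := by
    ext f
    rw [Module.End.mem_eigenspace_iff, ← S.hamiltonian_apply_eq_zero_iff hζ, Complex.ofReal_zero,
      zero_smul]
  refine ⟨0, ?_, fun μ hμ => ?_, hker⟩
  · rwa [Module.End.hasEigenvalue_iff, ← hker]
  · obtain ⟨f, hf, hf0⟩ := hμ.exists_hasEigenvector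
    have h := S.star_dotProduct_hamiltonian hζ f
    rw [Module.End.mem_eigenspace_iff.mp hf, dotProduct_smul, star_dotProduct_self_eq_ofReal,
      smul_eq_mul] at h
    have hne : ∑ c, ‖f c‖ ^ 2 ≠ 0 := (sum_norm_sq_eq_zero_iff f).not.mpr hf0
    -- The eigenvalue is the Rayleigh quotient `⟨f, Hf⟩ / ⟨f, f⟩` of an eigenvector.
    refine ⟨(∑ x, ∑ c, ‖(f - S.op x f) c‖ ^ 2) / ∑ c, ‖f c‖ ^ 2, ?_, by positivity⟩
    rw [Complex.ofReal_div, ← h, mul_div_cancel_right₀]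
    exact_mod_cast hne

end GroundSpace

/-! ### States as functions on a subquotient -/

section Encoding

/-- If `W` consists of the states that are pulled back along the surjective partial map `cl`, then
it encodes `ℂ[M]`. -/
lemma Encodes.of_mem_iff {C : Type u} {M : Type v} [AddCommGroup M] {W : Submodule ℂ (C → ℂ)}
    {cl : C → Option M} (hcl : ∀ h, ∃ c, cl c = some h)
    (hW : ∀ f, f ∈ W ↔ ∃ φ : M → ℂ, ∀ c, f c = (cl c).elim 0 φ) : Encodes W cl := by
  let Φ₀ : (M → ℂ) →ₗ[ℂ] W :=
    { toFun φ := ⟨fun c => (cl c).elim 0 φ, (hW _).mpr ⟨φ, fun _ => rfl⟩⟩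
      map_add' φ ψ := by
        ext c
        cases h : cl c <;> simp [h]
      map_smul' r φ := by
        ext c
        cases h : cl c <;> simp [h] }
  have hinj : Function.Injective Φ₀ := fun φ ψ h => by
    ext x
    obtain ⟨c, hc⟩ := hcl x
    have h1 := congrFun (congrArg Subtype.val h) c
    simpa [Φ₀, hc] using h1
  have hsurj : Function.Surjective Φ₀ := fun ⟨f, hf⟩ => by
    obtain ⟨φ, hφ⟩ := (hW f).mp hf
    exact ⟨φ, Subtype.ext (funext fun c => (hφ c).symm)⟩
  let Φ := LinearEquiv.ofBijective Φ₀ ⟨hinj, hsurj⟩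
  let ι : AddMonoidAlgebra ℂ M →ₗ[ℂ] M → ℂ :=
    Finsupp.lcoeFun ∘ₗ (AddMonoidAlgebra.coeffLinearEquiv ℂ).toLinearMap
  have hι (x : AddMonoidAlgebra ℂ M) : ι x = ⇑x.coeff := rfl
  refine ⟨Φ, fun φ c => rfl, Φ.toLinearMap ∘ₗ ι, ?_, fun h c => ?_, fun _ => ?_⟩
  · refine Φ.injective.comp fun x y hxy => ?_
    rw [hι, hι] at hxy
    exact AddMonoidAlgebra.coeff_injective (DFunLike.coe_injective hxy)
  · have h1 : ι (AddMonoidAlgebra.single h 1) = Set.indicator {h} 1 := by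
      rw [hι]
      ext x
      classical
      simp [Set.indicator_apply, Finsupp.single_apply, eq_comm]
    rw [← h1]
    rfl
  · refine Φ.surjective.comp fun φ => ?_
    -- On a finite group every function is a finite formal sum.
    exact ⟨.ofCoeff (Finsupp.equivFunOnFinite.symm φ), by rw [hι]; simp⟩

open Classical in
/-- The class modulo `B` of an element, if the element lies in `Z`. -/
def subquotientClass {C : Type u} [AddCommGroup C] (Z B : AddSubgroup C) (z : C) :
    Option (Z ⧸ B.addSubgroupOf Z) :=
  if h : z ∈ Z then some (QuotientAddGroup.mk ⟨z, h⟩) else none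

/-- The states supported on `Z` and invariant under `B` encode the functions on `Z / B`. -/
lemma Encodes.subquotientClass {Q : Type u} {C : Type v} [AddCommGroup C] {Z B : AddSubgroup C}
    (hB : B ≤ Z) {χ : Q → C} (hχ : Function.Surjective χ) {W : Submodule ℂ (Q → ℂ)}
    (hW : ∀ f, f ∈ W ↔ (∀ q, χ q ∉ Z → f q = 0) ∧ ∀ q q', χ q - χ q' ∈ B → f q = f q') :
    Encodes W fun q => subquotientClass Z B (χ q) := by
  have hsome {q : Q} (h : χ q ∈ Z) : _root_.subquotientClass Z B (χ q) =
      some (QuotientAddGroup.mk ⟨χ q, h⟩) := dif_pos h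
  have hnone {q : Q} (h : χ q ∉ Z) : _root_.subquotientClass Z B (χ q) = none := dif_neg h
  have hcl (h : Z ⧸ B.addSubgroupOf Z) : ∃ q, _root_.subquotientClass Z B (χ q) = some h := by
    obtain ⟨⟨z, hz⟩, rfl⟩ := QuotientAddGroup.mk_surjective h
    obtain ⟨q, rfl⟩ := hχ z
    exact ⟨q, hsome hz⟩
  refine Encodes.of_mem_iff hcl fun f => ?_
  rw [hW]
  constructor
  · rintro ⟨h1, h2⟩
    -- The function on classes is read off at chosen representatives; invariance under `B` makes the
    -- choice irrelevant.
    choose r hr using hcl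
    refine ⟨fun h => f (r h), fun q => ?_⟩
    by_cases hq : χ q ∈ Z
    · rw [hsome hq, Option.elim_some]
      refine (h2 _ _ ?_).symm
      have h3 := hr (QuotientAddGroup.mk ⟨χ q, hq⟩)
      have hrZ : χ (r (QuotientAddGroup.mk ⟨χ q, hq⟩)) ∈ Z := by
        by_contra h4
        rw [hnone h4] at h3
        exact Option.some_ne_none _ h3.symm
      rw [hsome hrZ, Option.some_inj, eq_comm, QuotientAddGroup.eq,
        AddSubgroup.mem_addSubgroupOf] at h3
      simpa [sub_eq_neg_add] using h3
    · rw [hnone hq, h1 q hq, Option.elim_none]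
  · rintro ⟨φ, hφ⟩
    refine ⟨fun q hq => by rw [hφ, hnone hq, Option.elim_none], fun q q' hqq' => ?_⟩
    rw [hφ, hφ]
    -- Since `B ≤ Z`, membership in `Z` depends only on the coset of `B`.
    by_cases hq' : χ q' ∈ Z
    · have hq : χ q ∈ Z := by simpa using Z.add_mem (hB hqq') hq'
      rw [hsome hq, hsome hq', Option.elim_some, Option.elim_some]
      congr 1
      rw [eq_comm, QuotientAddGroup.eq, AddSubgroup.mem_addSubgroupOf]
      simpa [sub_eq_neg_add] using hqq'
    · have hq : χ q ∉ Z := fun h => hq' (by simpa using Z.sub_mem h (hB hqq'))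
      rw [hnone hq, hnone hq']

end Encoding

/-! ### Integer matrices acting on arbitrary coefficients -/

section IntMatrix

variable {J K L : Type*} [Fintype J] [Fintype K]

/-- The homomorphism between families of elements of `A` that is given by an integer matrix. -/
def intMatrixHom (M : K → L → ℤ) (A : Type*) [AddCommGroup A] : (K → A) →+ (L → A) where
  toFun z f := ∑ x, M x f • z x
  map_zero' := by ext; simp
  map_add' z w := by ext; simp [Finset.sum_add_distrib]

lemma intMatrixHom_apply (M : K → L → ℤ) {A : Type*} [AddCommGroup A] (z : K → A) (f : L) :
    intMatrixHom M A z f = ∑ x, M x f • z x := rfl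

lemma intMatrixHom_single [DecidableEq K] (M : K → L → ℤ) {A : Type*} [AddCommGroup A] (x : K)
    (a : A) : intMatrixHom M A (Pi.single x a) = fun f => M x f • a := by
  ext f
  rw [intMatrixHom_apply, Finset.sum_eq_single x]
  · simp
  · intro y _ hy
    simp [Pi.single_eq_of_ne hy]
  · simp

/-- Naturality in the coefficients; applied to the projections `A → B i`, it reduces questions about
kernels and ranges to the factors. -/
lemma map_intMatrixHom (M : K → L → ℤ) {A B : Type*} [AddCommGroup A] [AddCommGroup B]
    (g : A →+ B) (z : K → A) (f : L) :
    g (intMatrixHom M A z f) = intMatrixHom M B (fun x => g (z x)) f := by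
  simp [intMatrixHom_apply]

lemma range_intMatrixHom_le_ker {N : J → K → ℤ} {M : K → L → ℤ}
    (h : ∀ x z, ∑ y, N x y * M y z = 0) (A : Type*) [AddCommGroup A] :
    (intMatrixHom N A).range ≤ (intMatrixHom M A).ker := by
  rintro _ ⟨z, rfl⟩
  rw [AddMonoidHom.mem_ker]
  ext f
  simp only [intMatrixHom_apply, Finset.smul_sum, smul_smul, Pi.zero_apply]
  rw [Finset.sum_comm]
  refine Finset.sum_eq_zero fun x _ => ?_
  rw [← Finset.sum_smul]
  simp_rw [mul_comm (M _ f)]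
  rw [h, zero_smul]

/-- Homology with coefficients in a product is the product of the homology groups. -/
lemma nonempty_addEquiv_pi_subquotient (N : J → K → ℤ) (M : K → L → ℤ) {A : Type*} [AddCommGroup A]
    {I : Type*} {B : I → Type*} [∀ i, AddCommGroup (B i)] (e : A ≃+ ∀ i, B i) :
    Nonempty ((intMatrixHom M A).ker ⧸
        (intMatrixHom N A).range.addSubgroupOf (intMatrixHom M A).ker ≃+
      ∀ i, (intMatrixHom M (B i)).ker ⧸
        (intMatrixHom N (B i)).range.addSubgroupOf (intMatrixHom M (B i)).ker) := by
  let p (i : I) : A →+ B i := (Pi.evalAddMonoidHom B i).comp e.toAddMonoidHom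
  have hp (i : I) (a : A) : p i a = e a i := rfl
  have hp_ext {a b : A} (h : ∀ i, p i a = p i b) : a = b := e.injective (funext h)
  let φ (i : I) : (intMatrixHom M A).ker →+ (intMatrixHom M (B i)).ker :=
    (((p i).compLeft K).comp (intMatrixHom M A).ker.subtype).codRestrict _ fun z => by
      rw [AddMonoidHom.mem_ker]
      ext f
      refine (map_intMatrixHom M (p i) z.1 f).symm.trans ?_
      rw [AddMonoidHom.mem_ker.mp z.2]
      exact map_zero _
  have hφ (i : I) (z) (x : K) : (φ i z).1 x = e (z.1 x) i := rfl
  let q (i : I) := QuotientAddGroup.mk' ((intMatrixHom N (B i)).range.addSubgroupOf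
    (intMatrixHom M (B i)).ker)
  let ψ := AddMonoidHom.mk' (fun z i => q i (φ i z)) fun z w => by
    ext i
    simp only [map_add, Pi.add_apply]
  have hψ (z) (i) : ψ z i = q i (φ i z) := rfl
  have hsurj : Function.Surjective ψ := fun y => by
    -- Representatives are chosen in each factor separately and assembled through `e.symm`; the
    -- result is a cycle because this is tested coordinatewise.
    choose w hw using fun i => QuotientAddGroup.mk'_surjective _ (y i)
    refine ⟨⟨fun x => e.symm fun i => (w i).1 x, ?_⟩, ?_⟩
    · rw [AddMonoidHom.mem_ker]
      ext f
      refine hp_ext fun i => ?_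
      rw [map_intMatrixHom, Pi.zero_apply, map_zero]
      simp only [hp, AddEquiv.apply_symm_apply]
      exact congrFun (AddMonoidHom.mem_ker.mp (w i).2) f
    · ext i
      rw [hψ, ← hw i]
      refine congrArg (q i) (Subtype.ext (funext fun x => ?_))
      rw [hφ]
      simp
  have hker : (intMatrixHom N A).range.addSubgroupOf (intMatrixHom M A).ker = ψ.ker := by
    ext z
    rw [AddMonoidHom.mem_ker, AddSubgroup.mem_addSubgroupOf, funext_iff]
    have h (i : I) : ψ z i = 0 ↔ (φ i z).1 ∈ (intMatrixHom N (B i)).range :=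
      QuotientAddGroup.eq_zero_iff _
    simp only [Pi.zero_apply, h]
    constructor
    · rintro ⟨w, hw⟩ i
      refine ⟨fun x => p i (w x), funext fun x => ?_⟩
      rw [← map_intMatrixHom, hw]
      rfl
    · intro hz
      -- Preimages under `N` in the separate factors likewise assemble to one preimage over `A`.
      choose w hw using hz
      refine ⟨fun x => e.symm fun i => w i x, funext fun x => hp_ext fun i => ?_⟩
      rw [map_intMatrixHom]
      simp only [hp, AddEquiv.apply_symm_apply]
      exact congrFun (hw i) x
  exact ⟨(QuotientAddGroup.quotientAddEquivOfEq hker).trans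
    (QuotientAddGroup.quotientKerEquivOfSurjective ψ hsurj)⟩

end IntMatrix

/-! ### CSS codes of a pair of composable integer matrices -/

section CSSCodes

/-- Qudits outside the `i`-th factor contribute `1`, so a single power of `ζ i` remains, to which
`IsClockPhase.zpow_eq_one_iff` applies. -/
lemma prod_onFactor {K : Type u} [Fintype K] {m : ℕ} (d : Fin m → ℕ) {ζ : Fin m → ℂ}
    (hζ : ∀ i, IsClockPhase (d i) (ζ i)) (i : Fin m) (b : K → ℤ) (n : K × Fin m → ℤ) :
    ∏ p : K × Fin m, (ζ p.2 ^ n p) ^ onFactor i b p = ζ i ^ ∑ x, n (x, i) * b x := by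
  rw [Fintype.prod_prod_type]
  have h (s : Finset K) (g : K → ℤ) : ζ i ^ ∑ x ∈ s, g x = ∏ x ∈ s, ζ i ^ g x := by
    classical
    induction s using Finset.induction_on with
    | empty => simp
    | insert x s hx ih =>
      rw [Finset.sum_insert hx, Finset.prod_insert hx, zpow_add₀ (hζ i).ne_zero, ih]
  rw [h]
  refine Finset.prod_congr rfl fun x _ => ?_
  rw [Finset.prod_eq_single i]
  · simp [onFactor, zpow_mul]
  · intro j _ hj
    simp [onFactor, hj]
  · simp

/-- For `i ≠ j` the operators act on disjoint sets of qudits; for `i = j` the commutation phase is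
`ζ i` to the power `∑ x, a x * b x`. -/
lemma commute_clockOp_shiftOp_onFactor {K : Type u} [Fintype K] {m : ℕ} {d : Fin m → ℕ}
    {ζ : Fin m → ℂ} (hζ : ∀ i, IsClockPhase (d i) (ζ i)) {a b : K → ℤ}
    (h : ∑ x, a x * b x = 0) (i j : Fin m) :
    Commute (clockOp (fun p : K × Fin m => d p.2) (fun p => ζ p.2) (onFactor i b))
      (shiftOp (fun p : K × Fin m => d p.2) (onFactor j a)) := by
  refine commute_clockOp_shiftOp (fun p : K × Fin m => hζ p.2) ?_
  simp_rw [zpow_mul]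
  rw [prod_onFactor d hζ]
  rcases eq_or_ne i j with rfl | hij
  · simp [onFactor, h]
  · simp [onFactor, hij]

variable {K J L : Type u} {m : ℕ}

/-- The code with relabelled stabilizers. -/
def StabilizerCode.reindex {P : Type u} {d : P → ℕ} [Fintype P] {ζ : P → ℂ} {G G' : Type*}
    (S : StabilizerCode d ζ G) (g : G' ≃ G) : StabilizerCode d ζ G' where
  op x := S.op (g x)
  isPauli x := S.isPauli (g x)
  commute x y := S.commute (g x) (g y)

lemma StabilizerCode.codeSpace_reindex {P : Type u} {d : P → ℕ} [Fintype P] {ζ : P → ℂ}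
    {G G' : Type*} (S : StabilizerCode d ζ G) (g : G' ≃ G) :
    (S.reindex g).codeSpace = S.codeSpace :=
  g.iInf_comp (g := fun x => LinearMap.ker (S.op x - 1))

variable {d : Fin m → ℕ} {A : Type v} [AddCommGroup A]

/-- Basis labels of the qudits form the group of families of elements of `A`. -/
def configAddEquiv (K : Type u) (e : A ≃+ ∀ i, ZMod (d i)) :
    QuditConfig (fun p : K × Fin m => d p.2) ≃+ (K → A) where
  toFun c y := e.symm fun i => c (y, i)
  invFun z p := e (z p.1) p.2
  left_inv c := by ext; simp
  right_inv z := by ext; simp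
  map_add' c c' := funext fun y => e.symm.map_add (fun i => c (y, i)) fun i => c' (y, i)

lemma configAddEquiv_apply (e : A ≃+ ∀ i, ZMod (d i))
    (c : QuditConfig (fun p : K × Fin m => d p.2)) (y : K) :
    configAddEquiv K e c y = e.symm fun i => c (y, i) := rfl

/-- Invariance under the shift operators is invariance under the range of the matrix `N`. -/
lemma forall_shift_invariant_iff [Fintype J] (e : A ≃+ ∀ i, ZMod (d i)) (N : J → K → ℤ)
    (f : QuditState (fun p : K × Fin m => d p.2)) :
    (∀ x i c, f (fun p => c p - (onFactor i (N x) p : ZMod (d p.2))) = f c) ↔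
      ∀ c c', configAddEquiv K e c - configAddEquiv K e c' ∈ (intMatrixHom N A).range →
        f c = f c' := by
  classical
  let s (x : J) (i : Fin m) : QuditConfig (fun p : K × Fin m => d p.2) :=
    fun p => (onFactor i (N x) p : ZMod (d p.2))
  -- The shift attached to `(x, i)` is the image under `N` of the chain at `x` with coefficient the
  -- `i`-th standard generator of `A`.
  have hs (x : J) (i : Fin m) : configAddEquiv K e (s x i) =
      intMatrixHom N A (Pi.single x (e.symm (Pi.single i 1))) := by
    rw [intMatrixHom_single]
    ext y
    rw [configAddEquiv_apply, ← map_zsmul]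
    congr 1
    ext j
    rcases eq_or_ne j i with rfl | hij
    · simp [s, onFactor]
    · simp [s, onFactor, hij]
  constructor
  · intro h
    -- The translations that preserve `f` form a subgroup, so invariance need only be known on
    -- generators of the range.
    let T : AddSubgroup (QuditConfig (fun p : K × Fin m => d p.2)) :=
      { carrier := {a | ∀ c, f (c - a) = f c}
        zero_mem' := fun c => by rw [sub_zero]
        add_mem' := fun {a b} ha hb c => by rw [← sub_sub, hb, ha]
        neg_mem' := fun {a} ha c => by rw [← ha (c - -a), sub_neg_eq_add, add_sub_cancel_right] }
    have hT (w : J → A) : (configAddEquiv K e).symm (intMatrixHom N A w) ∈ T := by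
      -- Chains are integer combinations of elementary ones, with integer lifts of the coordinates
      -- of `w x` as coefficients.
      have hw : w = ∑ x, ∑ i, ((e (w x) i).cast : ℤ) • Pi.single x (e.symm (Pi.single i 1)) := by
        ext x
        apply e.injective
        ext i
        rw [Finset.sum_apply, Finset.sum_eq_single x, Finset.sum_apply, map_sum, Finset.sum_apply,
          Finset.sum_eq_single i]
        · rw [Pi.smul_apply, Pi.single_eq_same, map_zsmul, AddEquiv.apply_symm_apply, Pi.smul_apply,
            Pi.single_eq_same]
          simp
        · intro j _ hj
          rw [Pi.smul_apply, Pi.single_eq_same, map_zsmul, AddEquiv.apply_symm_apply, Pi.smul_apply,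
            Pi.single_eq_of_ne hj.symm, smul_zero]
        · simp
        · intro y _ hy
          simp [Pi.single_eq_of_ne hy.symm]
        · simp
      rw [hw]
      simp only [map_sum, map_zsmul]
      refine sum_mem fun x _ => sum_mem fun i _ => zsmul_mem ?_ _
      rw [← hs, AddEquiv.symm_apply_apply]
      exact h x i
    rintro c c' ⟨w, hw⟩
    have h1 := hT w c
    rw [hw, ← map_sub, AddEquiv.symm_apply_apply, sub_sub_cancel] at h1
    exact h1.symm
  · intro h x i c
    refine h _ _ (neg_mem_iff.mp ?_)
    rw [neg_sub, ← map_sub]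
    have h1 : c - (fun p => c p - (onFactor i (N x) p : ZMod (d p.2))) = s x i := by
      ext p
      simp [s]
    rw [h1, hs]
    exact ⟨_, rfl⟩

variable [Fintype K]

/-- The code on `m` qudits for each element of `K` whose stabilizers are the products of clock
operators given by the columns of `M` and the products of shift operators given by the rows
of `N`. -/
def cssCode (d : Fin m → ℕ) (ζ : Fin m → ℂ) (hζ : ∀ i, IsClockPhase (d i) (ζ i)) (N : J → K → ℤ)
    (M : K → L → ℤ) (h : ∀ x z, ∑ y, N x y * M y z = 0) :
    StabilizerCode (fun p : K × Fin m => d p.2) (fun p => ζ p.2) ((L × Fin m) ⊕ (J × Fin m)) where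
  op := Sum.elim (fun s => clockOp _ _ (onFactor s.2 fun y => M y s.1))
    fun s => shiftOp _ (onFactor s.2 (N s.1))
  isPauli := by
    rintro (s | s)
    · exact ⟨1, 0, _, norm_one, by rw [shiftOp_zero, one_mul, one_smul]; rfl⟩
    · exact ⟨1, _, 0, norm_one, by rw [clockOp_zero, mul_one, one_smul]; rfl⟩
  commute := by
    rintro (s | s) (t | t)
    · exact commute_clockOp _ _
    · exact commute_clockOp_shiftOp_onFactor hζ (h t.1 s.1) _ _
    · exact (commute_clockOp_shiftOp_onFactor hζ (h s.1 t.1) _ _).symm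
    · exact commute_shiftOp _ _

/-- The phases of the clock operators detect the kernel of the matrix `M`. -/
lemma configAddEquiv_mem_ker_iff {ζ : Fin m → ℂ} (hζ : ∀ i, IsClockPhase (d i) (ζ i))
    (e : A ≃+ ∀ i, ZMod (d i)) (M : K → L → ℤ) (c : QuditConfig (fun p : K × Fin m => d p.2)) :
    configAddEquiv K e c ∈ (intMatrixHom M A).ker ↔
      ∀ z i, ∏ p : K × Fin m, (ζ p.2 ^ ((c p).cast : ℤ)) ^ onFactor i (fun y => M y z) p = 1 := by
  rw [AddMonoidHom.mem_ker, funext_iff]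
  refine forall_congr' fun z => ?_
  rw [Pi.zero_apply, ← e.map_eq_zero_iff, funext_iff]
  refine forall_congr' fun i => ?_
  -- The eigenvalue is `1` iff its exponent vanishes in `ZMod (d i)`, and that exponent reduces to
  -- the `i`-th coordinate at `z` of the image of `c` under `M`.
  rw [prod_onFactor d hζ i _ fun p => ((c p).cast : ℤ), (hζ i).zpow_eq_one_iff]
  have h := map_intMatrixHom M ((Pi.evalAddMonoidHom (fun i => ZMod (d i)) i).comp e.toAddMonoidHom)
    (configAddEquiv K e c) z
  have h' : e (intMatrixHom M A (configAddEquiv K e c) z) i =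
      ∑ y, M y z • e (configAddEquiv K e c y) i := h
  rw [h', Pi.zero_apply]
  simp [configAddEquiv_apply, mul_comm]

variable [Fintype J]

/-- The code space consists of the states that are supported on the kernel of `M` and invariant
under the range of `N`. -/
lemma mem_codeSpace_cssCode {ζ : Fin m → ℂ} (hζ : ∀ i, IsClockPhase (d i) (ζ i)) (N : J → K → ℤ)
    (M : K → L → ℤ) (h : ∀ x z, ∑ y, N x y * M y z = 0) (e : A ≃+ ∀ i, ZMod (d i))
    (f : QuditState (fun p : K × Fin m => d p.2)) :
    f ∈ (cssCode d ζ hζ N M h).codeSpace ↔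
      (∀ c, configAddEquiv K e c ∉ (intMatrixHom M A).ker → f c = 0) ∧
      ∀ c c', configAddEquiv K e c - configAddEquiv K e c' ∈ (intMatrixHom N A).range →
        f c = f c' := by
  rw [← forall_shift_invariant_iff, StabilizerCode.codeSpace, Submodule.mem_iInf, Sum.forall]
  refine and_congr ?_ ?_
  · rw [Prod.forall]
    simp_rw [configAddEquiv_mem_ker_iff hζ]
    have h1 (z : L) (i : Fin m) := mem_ker_clockOp_sub_one (d := fun p : K × Fin m => d p.2)
      (ζ := fun p => ζ p.2) (b := onFactor i fun y => M y z) (f := f)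
    refine (forall₂_congr h1).trans ⟨fun h2 c hc => ?_, fun h2 z i c hc => h2 c fun h3 => hc (h3 z i)⟩
    push Not at hc
    obtain ⟨z, i, hc⟩ := hc
    exact h2 z i c hc
  · rw [Prod.forall]
    exact forall₂_congr fun x i => mem_ker_shiftOp_sub_one

/-- The code space of `cssCode` encodes the functions on the homology group `ker M / range N`. -/
theorem encodes_codeSpace_cssCode {ζ : Fin m → ℂ} (hζ : ∀ i, IsClockPhase (d i) (ζ i))
    (N : J → K → ℤ) (M : K → L → ℤ) (h : ∀ x z, ∑ y, N x y * M y z = 0)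
    (e : A ≃+ ∀ i, ZMod (d i)) :
    Encodes (cssCode d ζ hζ N M h).codeSpace fun c =>
      subquotientClass (intMatrixHom M A).ker (intMatrixHom N A).range (configAddEquiv K e c) :=
  Encodes.subquotientClass (range_intMatrixHom_le_ker h A) (configAddEquiv K e).surjective
    (mem_codeSpace_cssCode hζ N M h e)

/-- A space that encodes functions on a group is not trivial. -/
lemma Encodes.ne_bot {C : Type u} {M : Type v} [AddCommGroup M] {W : Submodule ℂ (C → ℂ)}
    {cl : C → Option M} (h : Encodes W cl) : W ≠ ⊥ := by
  obtain ⟨Φ, -⟩ := h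
  rintro rfl
  -- The constant functions `1` and `0` on `M` differ because a group is nonempty.
  exact one_ne_zero (Φ.injective (Subsingleton.elim (Φ 1) (Φ 0)))

end CSSCodes

/-! ### The cellular chain complex and the main theorem -/

section CellularCodes

variable {X : Type u} [TopologicalSpace X] [T2Space X] (T : Set X) [CWComplex T]
  [RelCWComplex.Finite T]

/-- The incidence matrices of consecutive dimensions compose to zero. -/
lemma sum_incidence_mul_incidence (k : ℕ) (γ : RelCWComplex.cell T (k + 1)) (α : PrevCell T k) :
    ∑ β, incidence T (k + 1) γ β * incidence T k β α = 0 := by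
  cases k with
  | zero => exact α.elim
  | succ k =>
    change ∑ β, cellularIncidence T (k + 1) γ β * cellularIncidence T k β α = 0
    -- Both incidence numbers come from the same chosen complex, so `bd_bd` applies; without a
    -- complex both are the default `0`.
    unfold cellularIncidence
    split_ifs with hT
    · have h := DFunLike.congr_fun (hT.some.bd_bd k γ) α
      rw [Finsupp.linearCombination_apply, Finsupp.sum_fintype _ _ fun _ => by exact zero_smul _ _] at h
      simpa using h
    · simp

end CellularCodes

end

theorem mainTheorem2 {X : Type u} [TopologicalSpace X] [T2Space X] (T : Set X) [CWComplex T]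
    [RelCWComplex.Finite T] (A : Type v) [AddCommGroup A] [AddGroup.FG A] (k : ℕ) :
    (∃ (m : ℕ) (d : Fin m → ℕ) (ζ : Fin m → ℂ),
      Nonempty (A ≃+ ∀ i, ZMod (d i)) ∧ ∀ i, IsClockPhase (d i) (ζ i)) ∧
    ∀ (m : ℕ) (d : Fin m → ℕ) (ζ : Fin m → ℂ) (e : A ≃+ ∀ i, ZMod (d i)),
      (∀ i, IsClockPhase (d i) (ζ i)) →
      -- the homology code
      (∃ S : StabilizerCode (cellDim T k d) (cellPhase T k ζ) (CellGen T k m),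
        (∀ α i, S.op (Sum.inl (α, i)) = clockOp (cellDim T k d) (cellPhase T k ζ)
          (onFactor i fun β => incidence T k β α)) ∧
        (∀ γ i, S.op (Sum.inr (γ, i)) = shiftOp (cellDim T k d)
          (onFactor i fun β => incidence T (k + 1) γ β)) ∧
        Encodes S.codeSpace (fun c => homologyClass T A k (chainOfConfig T k e c)) ∧
        (∀ [Fintype (QuditConfig (cellDim T k d))], IsGroundSpace S.hamiltonian S.codeSpace)) ∧
      -- the cohomology code, with clock and shift operators exchanged
      (∃ S : StabilizerCode (cellDim T k d) (cellPhase T k ζ) (CellGen T k m),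
        (∀ α i, S.op (Sum.inl (α, i)) = shiftOp (cellDim T k d)
          (onFactor i fun β => incidence T k β α)) ∧
        (∀ γ i, S.op (Sum.inr (γ, i)) = clockOp (cellDim T k d) (cellPhase T k ζ)
          (onFactor i fun β => incidence T (k + 1) γ β)) ∧
        Encodes S.codeSpace (fun c => cohomologyClass T A k (chainOfConfig T k e c)) ∧
        (∀ [Fintype (QuditConfig (cellDim T k d))], IsGroundSpace S.hamiltonian S.codeSpace)) ∧
      -- homology and cohomology decompose along the factors of `A`
      Nonempty (CellularHomology T A k ≃+ ∀ i, CellularHomology T (ZMod (d i)) k) ∧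
      Nonempty (CellularCohomology T A k ≃+ ∀ i, CellularCohomology T (ZMod (d i)) k) := by
  refine ⟨?_, fun m d ζ e hζ => ⟨?_, ?_, ?_, ?_⟩⟩
  · obtain ⟨m, d, he⟩ := exists_addEquiv_pi_zmod A
    choose ζ hζ using fun i => exists_isClockPhase (d i)
    exact ⟨m, d, ζ, he, hζ⟩
  · let S := cssCode d ζ hζ (incidence T (k + 1)) (incidence T k) (sum_incidence_mul_incidence T k)
    -- Cycles, boundaries and classes unfold definitionally to kernel, range and `subquotientClass`
    -- of the incidence matrices.
    have hS : Encodes S.codeSpace fun c => homologyClass T A k (chainOfConfig T k e c) :=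
      encodes_codeSpace_cssCode hζ _ _ _ e
    exact ⟨S, fun _ _ => rfl, fun _ _ => rfl, hS,
      S.isGroundSpace_codeSpace (fun p => (hζ p.2).norm_eq_one) hS.ne_bot⟩
  · let S₀ := cssCode d ζ hζ (fun α β => incidence T k β α) (fun β γ => incidence T (k + 1) γ β)
      fun α γ => by simpa only [mul_comm] using sum_incidence_mul_incidence T k γ α
    -- In `cssCode` the clock operators come first. After transposition they belong to the
    -- `(k+1)`-cells, which `CellGen` lists second, so the two summands are swapped.
    let S := S₀.reindex (Equiv.sumComm _ _)
    have hS : Encodes S.codeSpace fun c => cohomologyClass T A k (chainOfConfig T k e c) := by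
      rw [StabilizerCode.codeSpace_reindex]
      exact encodes_codeSpace_cssCode hζ _ _ _ e
    exact ⟨S, fun _ _ => rfl, fun _ _ => rfl, hS,
      S.isGroundSpace_codeSpace (fun p => (hζ p.2).norm_eq_one) hS.ne_bot⟩
  · exact nonempty_addEquiv_pi_subquotient (incidence T (k + 1)) (incidence T k) e
  · exact nonempty_addEquiv_pi_subquotient (fun α β => incidence T k β α)
      (fun β γ => incidence T (k + 1) γ β) e
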